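/- Proposition 2 (continuous first fundamental theorem of projective geometry). Fields are not assumed commutative. For $i=1,2$ let $K_i$ be a field (division ring), let $E_i$ be a left vector space over $K_i$, let $F_i$ be a right vector space over $K_i$, and let $\mathcal B_i : E_i\times F_i\to K_i$ be a nondegenerate bilinear form: it is biadditive, $\mathcal B_i(kx,y)=k\,\mathcal B_i(x,y)$ and $\mathcal B_i(x,yk)=\mathcal B_i(x,y)\,k$ for all $k \in K_i$, $x\in E_i$, $y\in F_i$; the only $x\in E_i$ with $\mathcal B_i(x,y)=0$ for all $y\in F_i$ is $0$; and the only $y\in F_i$ with $\mathcal B_i(x,y)=0$ for all $x\in E_i$ is $0$. For a subspace $A$ of $E_i$ put $A^{\perp}=\{y\in F_i : \mathcal B_i(x,y)=0 \text{ for every } x\in A\}$ and $A^{\perp\perp}=\{x\in E_i : \mathcal B_i(x,y)=0\text{ for every }y\in A^\perp\}$. Call $A$ $F_i$-closed if $A=A^{\perp\perp}$, and let $L_{F_i}(E_i)$ be the lattice of all $F_i$-closed subspaces of $E_i$, ordered by inclusion. Assume that $\dim_{K_1}E_1\ge 3$ (possibly infinite), and let $\psi : L_{F_1}(E_1)\to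 L_{F_2}(E_2)$ be a lattice isomorphism. Then the fields $K_1$ and $K_2$ are isomorphic, and there are a field isomorphism $\sigma:K_1\to K_2$ and a $\sigma$-semilinear bijection $s:E_1\to E_2$ (that is, $s$ is additive and bijective, and $s(kx)=\sigma(k)s(x)$ for all $k\in K_1$, $x\in E_1$) such that $\psi(M)=s(M)$ for every $F_1$-closed subspace $M$ of $E_1$. -/

import Mathlib

/-! Throughout, `K` is a division ring (a not necessarily commutative field), `E` is a left vector
space over `K`, and `F` is a right vector space over `K`, that is, a module over `Kᵐᵒᵖ`, where
`op k • y` is the right multiple `y k`. A map `B : E →ₗ[K] F →ₗ[Kᵐᵒᵖ] K` is then exactly a bilinear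
form on `E × F`: it is biadditive, with `B (k x) y = k (B x y)` and `B x (y k) = (B x y) k`. -/

namespace DualPair

variable {K E F : Type*} [DivisionRing K] [AddCommGroup E] [Module K E]
  [AddCommGroup F] [Module Kᵐᵒᵖ F]

/-- The orthogonal in `F` of a subspace `A` of `E`. -/
def perpRight (B : E →ₗ[K] F →ₗ[Kᵐᵒᵖ] K) (A : Submodule K E) : Submodule Kᵐᵒᵖ F where
  carrier := {y | ∀ x ∈ A, B x y = 0}
  zero_mem' := fun x _ => map_zero (B x)
  add_mem' := fun {y z} hy hz x hx => by rw [map_add, hy x hx, hz x hx, add_zero]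
  smul_mem' := fun k y hy x hx => by rw [map_smul, hy x hx, smul_zero]

/-- The orthogonal in `E` of a subspace `C` of `F`. -/
def perpLeft (B : E →ₗ[K] F →ₗ[Kᵐᵒᵖ] K) (C : Submodule Kᵐᵒᵖ F) : Submodule K E where
  carrier := {x | ∀ y ∈ C, B x y = 0}
  zero_mem' := fun y _ => by rw [map_zero, LinearMap.zero_apply]
  add_mem' := fun {x z} hx hz y hy => by
    rw [map_add, LinearMap.add_apply, hx y hy, hz y hy, add_zero]
  smul_mem' := fun k x hx y hy => by
    rw [map_smul, LinearMap.smul_apply, hx y hy, smul_zero]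

/-- `B` makes `(E, F)` a pair of dual spaces: it is nondegenerate on both sides. -/
def IsDualPair (B : E →ₗ[K] F →ₗ[Kᵐᵒᵖ] K) : Prop :=
  (∀ x, (∀ y, B x y = 0) → x = 0) ∧ (∀ y, (∀ x, B x y = 0) → y = 0)

/-- A subspace `A` of `E` is `F`-closed if `A = A^⊥⊥`. -/
def IsFClosed (B : E →ₗ[K] F →ₗ[Kᵐᵒᵖ] K) (A : Submodule K E) : Prop :=
  A = perpLeft B (perpRight B A)

/-- The lattice `L_F(E)` of all `F`-closed subspaces of `E`, ordered by inclusion (the order is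
inherited from `Submodule K E`). Its lattice operations are determined by this order, so a lattice
isomorphism between two such lattices is the same as an order isomorphism `≃o`. -/
abbrev ClosedSubspaces (B : E →ₗ[K] F →ₗ[Kᵐᵒᵖ] K) : Type _ :=
  {A : Submodule K E // IsFClosed B A}

end DualPair

/-!
A lattice isomorphism `ψ` between the lattices of closed subspaces restricts to a collineation of
the underlying projective spaces, and the fundamental theorem of projective geometry says that, in
dimension at least three, a collineation comes from a semilinear bijection.

For the restriction one needs that subspaces of dimension at most two are closed
(`DualPair.IsFClosed.sup_span_singleton`). Hence the one-dimensional subspaces are the atoms of the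
lattice, so that `ψ` permutes them, and the line joining two points is their join in the lattice,
so that `ψ` respects incidence (`DualPair.isCollineation_apply_line`). A closed subspace is the
union of the one-dimensional subspaces in it, so a semilinear map that induces `ψ` on these
induces `ψ` on all closed subspaces.

The fundamental theorem (`IsCollineation.exists_semilinear`) is proved by choosing
representatives. Call representatives `x'`, `y'` of the images of the points of `x` and `y`
*compatible* if `x' - y'` represents the image of the point of `x - y`. Given `x'`, each other
point has a compatible representative, and compatibility is transitive by intersecting lines in a
plane, where a vector off the line in question handles collinear points; this is where dimension
three enters (`IsCollineation.compatible_trans`). So all representatives can be chosen compatible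
with each other, and then they form an additive map. This map sends `k x` to a multiple of the
image of `x`; comparing `x`, `y` and `x + y` shows that the factor depends only on `k`
(`exists_ringHom_map_smul`), and it is the required field isomorphism.
-/

open Submodule

/-! ### The fundamental theorem of projective geometry -/

section Collineation

variable {K L V W : Type*} [DivisionRing K] [DivisionRing L] [AddCommGroup V] [Module K V]
  [AddCommGroup W] [Module L W]

/-- A collineation from the projective space of `V` to that of `W`. It is encoded as a map `P` on
the vectors of `V`, where `P x` is the image of the point `K ∙ x`: the values of `P` are exactly
the points `L ∙ y` together with `⊥`, and `P` preserves and reflects incidence of a point with the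
line through two points. These axioms force `P 0 = ⊥`. -/
structure IsCollineation (K : Type*) {L V W : Type*} [DivisionRing K] [DivisionRing L]
    [AddCommGroup V] [Module K V] [AddCommGroup W] [Module L W] (P : V → Submodule L W) :
    Prop where
  exists_eq_span (x : V) : ∃ y, P x = L ∙ y
  exists_span_eq (y : W) : ∃ x, P x = L ∙ y
  le_sup_iff (x y z : V) : P x ≤ P y ⊔ P z ↔ x ∈ span K {y, z}

/-- The representatives `x'` of the point `P x` and `y'` of `P y` are compatible if `x' - y'`
represents `P (x - y)`. -/
structure Compatible (P : V → Submodule L W) (x : V) (x' : W) (y : V) (y' : W) : Prop where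
  left : P x = L ∙ x'
  right : P y = L ∙ y'
  sub : P (x - y) = L ∙ (x' - y')

theorem linearIndependent_pair_iff_notMem {x y : V} :
    LinearIndependent K ![x, y] ↔ x ≠ 0 ∧ y ∉ K ∙ x := by
  constructor
  · intro h
    have hx : x ≠ 0 := h.ne_zero 0
    refine ⟨hx, fun hy => ?_⟩
    obtain ⟨a, ha⟩ := mem_span_singleton.1 hy
    exact (LinearIndependent.pair_iff' hx).1 h a ha
  · rintro ⟨hx, hy⟩
    exact (LinearIndependent.pair_iff' hx).2 fun a ha => hy (mem_span_singleton.2 ⟨a, ha⟩)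

theorem linearIndependent_pair_of_notMem_left {x y z : V} (hx : x ≠ 0)
    (hz : z ∉ span K {x, y}) : LinearIndependent K ![x, z] :=
  linearIndependent_pair_iff_notMem.2 ⟨hx, fun h => hz (span_mono (by simp) h)⟩

theorem linearIndependent_pair_of_notMem_right {x y z : V} (hy : y ≠ 0)
    (hz : z ∉ span K {x, y}) : LinearIndependent K ![y, z] :=
  linearIndependent_pair_iff_notMem.2 ⟨hy, fun h => hz (span_mono (by simp) h)⟩

/-- Two independent vectors of the plane `⟨x, y⟩` span it. -/
theorem span_pair_eq_of_mem {x y z : V} (hxz : LinearIndependent K ![x, z])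
    (hz : z ∈ span K {x, y}) : span K {x, z} = span K {x, y} := by
  obtain ⟨a, b, rfl⟩ := mem_span_pair.1 hz
  have hb : b ≠ 0 := by
    rintro rfl
    exact (linearIndependent_pair_iff_notMem.1 hxz).2
      (mem_span_singleton.2 ⟨a, by simp⟩)
  refine le_antisymm (span_le.2 ?_) (span_le.2 ?_)
  · rintro w (rfl | rfl)
    · exact subset_span (by simp)
    · exact hz
  · rintro w (rfl | rfl)
    · exact subset_span (by simp)
    · refine mem_span_pair.2 ⟨-(b⁻¹ * a), b⁻¹, ?_⟩
      rw [smul_add, smul_smul, smul_smul, inv_mul_cancel₀ hb, one_smul, neg_smul]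
      abel

theorem exists_notMem_span_pair (h : 3 ≤ Module.rank K V) (x y : V) :
    ∃ z, z ∉ span K {x, y} := by
  classical
  by_contra! hall
  have htop : span K (({x, y} : Finset V) : Set V) = ⊤ := by
    rw [eq_top_iff]
    intro z _
    simpa using hall z
  have h1 := rank_span_finset_le (R := K) ({x, y} : Finset V)
  rw [htop, rank_top] at h1
  have h2 : ((({x, y} : Finset V).card : ℕ) : Cardinal) ≤ (2 : ℕ) := by
    exact_mod_cast Finset.card_le_two
  have h3 := h.trans (h1.trans h2)
  exact absurd h3 (by norm_cast)

namespace IsCollineation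

variable {P : V → Submodule L W} (hP : IsCollineation K P)
include hP

theorem apply_zero : P 0 = ⊥ := by
  obtain ⟨x, hx⟩ := hP.exists_span_eq 0
  rw [span_zero_singleton] at hx
  have := (hP.le_sup_iff 0 x x).2 (zero_mem _)
  rwa [hx, sup_bot_eq, le_bot_iff] at this

theorem eq_zero_iff {x : V} {x' : W} (hx : P x = L ∙ x') : x' = 0 ↔ x = 0 := by
  constructor
  · rintro rfl
    have := (hP.le_sup_iff x 0 0).1 (by simp [hx])
    simpa using this
  · rintro rfl
    simpa [hP.apply_zero] using hx.symm

theorem mem_span_pair_iff {x y z : V} {x' y' z' : W} (hx : P x = L ∙ x') (hy : P y = L ∙ y')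
    (hz : P z = L ∙ z') : x' ∈ span L {y', z'} ↔ x ∈ span K {y, z} := by
  rw [← hP.le_sup_iff, hx, hy, hz, span_insert, span_singleton_le_iff_mem]

theorem mem_span_singleton_iff {x y : V} {x' y' : W} (hx : P x = L ∙ x') (hy : P y = L ∙ y') :
    x' ∈ L ∙ y' ↔ x ∈ K ∙ y := by
  simpa using hP.mem_span_pair_iff hx hy hy

theorem linearIndependent_pair_iff {x y : V} {x' y' : W} (hx : P x = L ∙ x')
    (hy : P y = L ∙ y') : LinearIndependent L ![x', y'] ↔ LinearIndependent K ![x, y] := by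
  rw [linearIndependent_pair_iff_notMem, linearIndependent_pair_iff_notMem,
    hP.mem_span_singleton_iff hy hx, Ne, hP.eq_zero_iff hx]

theorem apply_smul {c : K} (hc : c ≠ 0) (x : V) : P (c • x) = P x := by
  apply le_antisymm
  · have := (hP.le_sup_iff (c • x) x x).2 (smul_mem _ c (subset_span (by simp)))
    rwa [sup_idem] at this
  · have := (hP.le_sup_iff x (c • x) (c • x)).2 (by
      simpa [smul_smul, hc] using
        smul_mem (K ∙ (c • x)) c⁻¹ (mem_span_singleton_self (c • x)))
    rwa [sup_idem] at this

theorem apply_neg (x : V) : P (-x) = P x := by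
  simpa using hP.apply_smul (neg_ne_zero.2 one_ne_zero : (-1 : K) ≠ 0) x

theorem compatible_symm {x y : V} {x' y' : W} (h : Compatible P x x' y y') :
    Compatible P y y' x x' := by
  refine ⟨h.right, h.left, ?_⟩
  rw [← neg_sub x y, hP.apply_neg, h.sub, ← neg_sub x' y', ← Set.neg_singleton, span_neg]

/-- A representative `x'` of `P x` normalizes the representative of any other point `P y`. -/
theorem exists_compatible {x y : V} {x' : W} (hx : P x = L ∙ x')
    (h : LinearIndependent K ![x, y]) : ∃ y', Compatible P x x' y y' := by
  obtain ⟨z, hy⟩ := hP.exists_eq_span y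
  obtain ⟨w, hw⟩ := hP.exists_eq_span (x - y)
  have hmem : w ∈ span L {x', z} := (hP.mem_span_pair_iff hw hx hy).2
    (mem_span_pair.2 ⟨1, -1, by simp [sub_eq_add_neg]⟩)
  obtain ⟨a, b, rfl⟩ := mem_span_pair.1 hmem
  rw [← neg_neg b] at hw
  have ha : a ≠ 0 := by
    rintro rfl
    have h1 := (hP.mem_span_singleton_iff hw hy).1 (mem_span_singleton.2 ⟨- -b, by simp⟩)
    have h2 : x ∈ K ∙ y := by simpa using add_mem h1 (mem_span_singleton_self y)
    exact (linearIndependent_pair_iff_notMem.1 (LinearIndependent.pair_symm_iff.1 h)).2 h2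
  have hb : -b ≠ 0 := by
    intro hb
    rw [hb] at hw
    have h1 := (hP.mem_span_singleton_iff hw hx).1 (mem_span_singleton.2 ⟨a, by simp⟩)
    have h2 : y ∈ K ∙ x := by simpa using sub_mem (mem_span_singleton_self x) h1
    exact (linearIndependent_pair_iff_notMem.1 h).2 h2
  refine ⟨(a⁻¹ * -b) • z, hx, ?_, ?_⟩
  · rw [hy, span_singleton_smul_eq (mul_ne_zero (inv_ne_zero ha) hb).isUnit]
  · rw [hw, ← span_singleton_smul_eq (inv_ne_zero ha).isUnit, smul_add, smul_smul, smul_smul,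
      inv_mul_cancel₀ ha, one_smul, mul_neg, neg_smul, sub_eq_add_neg]

/-- Compatibility is transitive on three points that are not collinear: the point `P (x - z)` is
the intersection of the lines `⟨x' - y', y' - z'⟩` and `⟨x', z'⟩`, hence represented by
`x' - z'`. -/
theorem compatible_trans_of_notMem {x y z : V} {x' y' z' : W}
    (hxy : LinearIndependent K ![x, y]) (hz : z ∉ span K {x, y})
    (h₁ : Compatible P x x' y y') (h₂ : Compatible P y y' z z') : Compatible P x x' z z' := by
  refine ⟨h₁.left, h₂.right, ?_⟩
  have hxy' := (hP.linearIndependent_pair_iff h₁.left h₁.right).2 hxy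
  have hz' : z' ∉ span L {x', y'} :=
    fun h => hz ((hP.mem_span_pair_iff h₂.right h₁.left h₁.right).1 h)
  obtain ⟨w, hw⟩ := hP.exists_eq_span (x - z)
  obtain ⟨a, b, rfl⟩ := mem_span_pair.1 ((hP.mem_span_pair_iff hw h₁.sub h₂.sub).2
    (mem_span_pair.2 ⟨1, 1, by simp⟩))
  obtain ⟨c, d, hcd⟩ := mem_span_pair.1 ((hP.mem_span_pair_iff hw h₁.left h₂.right).2
    (mem_span_pair.2 ⟨1, -1, by simp [sub_eq_add_neg]⟩))
  have hd : d + b = 0 := by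
    by_contra hne
    refine hz' ?_
    have : (d + b) • z' ∈ span L {x', y'} := mem_span_pair.2 ⟨a - c, b - a, by
      rw [← sub_eq_zero, ← sub_eq_zero.2 hcd.symm]
      simp only [add_smul, sub_smul, smul_sub]
      abel⟩
    simpa [smul_smul, hne] using smul_mem _ (d + b)⁻¹ this
  have h0 : (c - a) • x' + (a - b) • y' = 0 := by
    rw [eq_neg_of_add_eq_zero_left hd] at hcd
    rw [← sub_eq_zero.2 hcd]
    simp only [neg_smul, sub_smul, smul_sub]
    abel
  obtain ⟨-, hab⟩ := LinearIndependent.pair_iff.1 hxy' _ _ h0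
  obtain rfl := sub_eq_zero.1 hab
  rw [← smul_add, sub_add_sub_cancel] at hw
  have ha : a ≠ 0 := by
    rintro rfl
    have : x - z = 0 := (hP.eq_zero_iff hw).1 (zero_smul _ _)
    rw [sub_eq_zero] at this
    exact hz (this ▸ subset_span (by simp))
  rw [hw, span_singleton_smul_eq ha.isUnit]

/-- Compatibility is transitive on pairwise distinct points; if these are collinear, the
comparison is made through a fourth point off their line. -/
theorem compatible_trans (hV : 3 ≤ Module.rank K V) {x y z : V} {x' y' z' : W}
    (hxy : LinearIndependent K ![x, y]) (hyz : LinearIndependent K ![y, z])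
    (hxz : LinearIndependent K ![x, z]) (h₁ : Compatible P x x' y y')
    (h₂ : Compatible P y y' z z') : Compatible P x x' z z' := by
  by_cases hz : z ∈ span K {x, y}
  · obtain ⟨d, hd⟩ := exists_notMem_span_pair hV x y
    have hyx := LinearIndependent.pair_symm_iff.1 hxy
    have hd_yx : d ∉ span K {y, x} := by rwa [Set.pair_comm]
    have hd_xz : d ∉ span K {x, z} := by rwa [span_pair_eq_of_mem hxz hz]
    have hd_yz : d ∉ span K {y, z} := by
      rwa [span_pair_eq_of_mem hyz (by rwa [Set.pair_comm])]
    obtain ⟨d', h₃⟩ := hP.exists_compatible h₂.left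
      (linearIndependent_pair_of_notMem_right (hxy.ne_zero 1) hd)
    have h₄ : Compatible P x x' d d' := hP.compatible_trans_of_notMem hxy hd h₁ h₃
    have h₅ : Compatible P z z' d d' := hP.compatible_trans_of_notMem
      (LinearIndependent.pair_symm_iff.1 hyz) (by rwa [Set.pair_comm])
      (hP.compatible_symm h₂) h₃
    have hz_xd : z ∉ span K {x, d} := fun h => hd_xz <| by
      rw [span_pair_eq_of_mem hxz h]
      exact subset_span (by simp)
    exact hP.compatible_trans_of_notMem
      (linearIndependent_pair_of_notMem_left (hxy.ne_zero 0) hd) hz_xd h₄ (hP.compatible_symm h₅)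
  · exact hP.compatible_trans_of_notMem hxy hz h₁ h₂

/-- One can choose representatives of all points that are compatible for any two distinct points:
normalize by a vector `e`, and on `K ∙ e` itself by a vector off that line. -/
theorem exists_forall_compatible (hV : 3 ≤ Module.rank K V) :
    ∃ f : V → W, (∀ x, P x = L ∙ f x) ∧
      ∀ x y, LinearIndependent K ![x, y] → P (x - y) = L ∙ (f x - f y) := by
  classical
  obtain ⟨e, he⟩ := exists_notMem_span_pair (K := K) hV 0 0
  have he0 : e ≠ 0 := by
    rintro rfl
    exact he (zero_mem _)
  obtain ⟨e', hee'⟩ := hP.exists_eq_span e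
  obtain ⟨b, hb⟩ := exists_notMem_span_pair (K := K) hV e e
  have heb : LinearIndependent K ![e, b] := linearIndependent_pair_of_notMem_left he0 hb
  obtain ⟨b', heb'⟩ := hP.exists_compatible hee' heb
  have hex : ∀ x : V, ∃ x', P x = L ∙ x' ∧
      (LinearIndependent K ![e, x] → Compatible P e e' x x') ∧
      (x ≠ 0 → x ∈ K ∙ e → Compatible P b b' x x') := by
    intro x
    by_cases hx0 : x = 0
    · subst hx0
      exact ⟨0, by simp [hP.apply_zero], fun h => absurd rfl (h.ne_zero 1), fun h => absurd rfl h⟩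
    by_cases hx : x ∈ K ∙ e
    · have hbx : LinearIndependent K ![b, x] := by
        refine LinearIndependent.pair_symm_iff.1
          (linearIndependent_pair_iff_notMem.2 ⟨hx0, fun h => ?_⟩)
        exact (linearIndependent_pair_iff_notMem.1 heb).2
          ((span_singleton_le_iff_mem _ _).2 hx h)
      obtain ⟨x', h⟩ := hP.exists_compatible heb'.right hbx
      exact ⟨x', h.right, fun hl => absurd hx (linearIndependent_pair_iff_notMem.1 hl).2,
        fun _ _ => h⟩
    · obtain ⟨x', h⟩ := hP.exists_compatible hee' (linearIndependent_pair_iff_notMem.2 ⟨he0, hx⟩)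
      exact ⟨x', h.right, fun _ => h, fun _ hl => absurd hl hx⟩
  choose f hf hfe hfb using hex
  -- The comparison of a vector on `K ∙ e` with one off it.
  have hmixed : ∀ x y, x ≠ 0 → x ∈ K ∙ e → LinearIndependent K ![e, y] →
      Compatible P x (f x) y (f y) := by
    intro x y hx0 hx hy
    have key : ∀ z, LinearIndependent K ![e, z] → LinearIndependent K ![x, z] := by
      intro z hz
      refine linearIndependent_pair_iff_notMem.2 ⟨hx0, fun h => ?_⟩
      exact (linearIndependent_pair_iff_notMem.1 hz).2 ((span_singleton_le_iff_mem _ _).2 hx h)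
    have hxb := hP.compatible_symm (hfb x hx0 hx)
    have heb_symm := LinearIndependent.pair_symm_iff.1 heb
    by_cases hby : LinearIndependent K ![b, y]
    · exact hP.compatible_trans hV (key b heb) hby (key y hy) hxb
        (hP.compatible_trans hV heb_symm hy hby (hP.compatible_symm heb') (hfe y hy))
    · -- Here `y` and `b` represent the same point, and a vector off `⟨e, b⟩` mediates.
      obtain ⟨d, hd⟩ := exists_notMem_span_pair (K := K) hV e b
      have hed := linearIndependent_pair_of_notMem_left he0 hd
      have hb0 : b ≠ 0 := heb.ne_zero 1
      have hbd := linearIndependent_pair_of_notMem_right hb0 hd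
      have hyb : y ∈ K ∙ b := by
        by_contra h
        exact hby (linearIndependent_pair_iff_notMem.2 ⟨hb0, h⟩)
      have hyd : LinearIndependent K ![y, d] := by
        refine linearIndependent_pair_iff_notMem.2 ⟨hy.ne_zero 1, fun h => ?_⟩
        exact (linearIndependent_pair_iff_notMem.1 hbd).2
          ((span_singleton_le_iff_mem _ _).2 hyb h)
      have hdy := LinearIndependent.pair_symm_iff.1 hyd
      have hbd' := hP.compatible_trans hV heb_symm hed hbd (hP.compatible_symm heb') (hfe d hed)
      have hdy' := hP.compatible_trans hV (LinearIndependent.pair_symm_iff.1 hed) hy hdy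
        (hP.compatible_symm (hfe d hed)) (hfe y hy)
      exact hP.compatible_trans hV (key d hed) hdy (key y hy)
        (hP.compatible_trans hV (key b heb) hbd (key d hed) hxb hbd') hdy'
  refine ⟨f, hf, fun x y hxy => ?_⟩
  have hx0 : x ≠ 0 := hxy.ne_zero 0
  have hy0 : y ≠ 0 := hxy.ne_zero 1
  by_cases hx : x ∈ K ∙ e
  · refine (hmixed x y hx0 hx (linearIndependent_pair_iff_notMem.2 ⟨he0, fun hy => ?_⟩)).sub
    obtain ⟨a, rfl⟩ := mem_span_singleton.1 hx
    have ha : a ≠ 0 := fun h => hx0 (by simp [h])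
    rw [linearIndependent_pair_iff_notMem, span_singleton_smul_eq ha.isUnit] at hxy
    exact hxy.2 hy
  · have hex := linearIndependent_pair_iff_notMem.2 ⟨he0, hx⟩
    by_cases hy : y ∈ K ∙ e
    · exact (hP.compatible_symm (hmixed y x hy0 hy hex)).sub
    · have hey := linearIndependent_pair_iff_notMem.2 ⟨he0, hy⟩
      exact (hP.compatible_trans hV (LinearIndependent.pair_symm_iff.1 hex) hey hxy
        (hP.compatible_symm (hfe x hex)) (hfe y hey)).sub

/-- Compatible representatives are additive. -/
theorem exists_addMonoidHom (hV : 3 ≤ Module.rank K V) :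
    ∃ f : V →+ W, ∀ x, P x = L ∙ f x := by
  obtain ⟨f, hf, hsub⟩ := hP.exists_forall_compatible hV
  have hf0 : f 0 = 0 := (hP.eq_zero_iff (hf 0)).2 rfl
  have hli : ∀ x y, LinearIndependent K ![x, y] → f (x - y) = f x - f y := by
    intro x y h
    have h' := (hP.linearIndependent_pair_iff (hf x) (hf y)).2 h
    have h1 : LinearIndependent K ![x, x - y] := by
      rw [sub_eq_add_neg, LinearIndependent.pair_add_right_iff,
        LinearIndependent.pair_neg_right_iff]
      exact h
    have h2 := hsub x (x - y) h1
    rw [sub_sub_cancel, hf y] at h2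
    obtain ⟨c, hc⟩ := mem_span_singleton.1 (h2.symm ▸ mem_span_singleton_self (f x - f (x - y)))
    have h3 := hsub x y h
    rw [hf] at h3
    obtain ⟨d, hd⟩ := mem_span_singleton.1 (h3 ▸ mem_span_singleton_self (f (x - y)))
    have h4 : (1 - d) • f x + (d - c) • f y = 0 := by
      rw [← hd] at hc
      rw [← sub_eq_zero.2 hc.symm]
      simp only [sub_smul, smul_sub, one_smul]
      abel
    obtain ⟨h5, -⟩ := LinearIndependent.pair_iff.1 h' _ _ h4
    rw [← hd, ← sub_eq_zero.1 h5, one_smul]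
  have hpartner : ∀ x : V, x ≠ 0 → ∃ z, LinearIndependent K ![z, x] := by
    intro x hx
    obtain ⟨z, hz⟩ := exists_notMem_span_pair (K := K) hV x x
    exact ⟨z, LinearIndependent.pair_symm_iff.1 (linearIndependent_pair_of_notMem_left hx hz)⟩
  have hneg : ∀ y, f (-y) = -f y := by
    intro y
    by_cases hy : y = 0
    · simp [hy, hf0]
    obtain ⟨z, hz⟩ := hpartner y hy
    have h1 : LinearIndependent K ![z - y, z] := by
      rw [LinearIndependent.pair_symm_iff, sub_eq_add_neg, LinearIndependent.pair_add_right_iff,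
        LinearIndependent.pair_neg_right_iff]
      exact hz
    have h2 := hli _ _ h1
    rw [hli _ _ hz] at h2
    simpa using h2
  refine ⟨AddMonoidHom.ofMapSub f fun x y => ?_, hf⟩
  by_cases hx : x = 0
  · simp [hx, hneg, hf0]
  by_cases hxy : LinearIndependent K ![x, y]
  · exact hli x y hxy
  have hyx : y ∈ K ∙ x := by
    by_contra h
    exact hxy (linearIndependent_pair_iff_notMem.2 ⟨hx, h⟩)
  by_cases hne : y = x
  · simp [hne, hf0]
  -- Both vectors are shifted by a vector off their common line.
  obtain ⟨c, rfl⟩ := mem_span_singleton.1 hyx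
  obtain ⟨z, hz⟩ := hpartner x hx
  have hc : c ≠ 1 := by
    rintro rfl
    exact hne (one_smul _ _)
  by_cases hc0 : c = 0
  · simp [hc0, hf0]
  have hzc : LinearIndependent K ![z, c • x] := by
    rw [LinearIndependent.pair_iff] at hz ⊢
    intro s t hst
    rw [smul_smul] at hst
    obtain ⟨h1, h2⟩ := hz _ _ hst
    exact ⟨h1, (mul_eq_zero.1 h2).resolve_right hc0⟩
  have h1 : LinearIndependent K ![z - x, z - c • x] := by
    rw [LinearIndependent.pair_iff] at hz ⊢
    intro s t hst
    have h0 : (s + t) • z + (-(s + t * c)) • x = 0 := by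
      rw [← hst]
      simp only [smul_sub, smul_smul, add_smul, neg_smul]
      abel
    obtain ⟨h2, h3⟩ := hz _ _ h0
    obtain rfl := eq_neg_of_add_eq_zero_left h2
    have h4 : t * (1 - c) = 0 := by
      rw [← h3]
      noncomm_ring
    have h5 : t = 0 := (mul_eq_zero.1 h4).resolve_right (sub_ne_zero.2 hc.symm)
    simp [h5]
  have h2 := hli _ _ h1
  rw [hli _ _ hz, hli _ _ hzc, sub_sub_sub_cancel_left, sub_sub_sub_cancel_left] at h2
  rw [← neg_sub, hneg, h2, neg_sub]

end IsCollineation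

/-- An additive map that respects independence of pairs and maps lines into lines is
semilinear. -/
theorem exists_ringHom_map_smul [Nontrivial V] (f : V →+ W)
    (hpartner : ∀ x : V, x ≠ 0 → ∃ z, LinearIndependent K ![x, z])
    (hli : ∀ x y, LinearIndependent K ![x, y] → LinearIndependent L ![f x, f y])
    (hsmul : ∀ (k : K) (x : V), ∃ c : L, f (k • x) = c • f x) :
    ∃ σ : K →+* L, ∀ (k : K) (x : V), f (k • x) = σ k • f x := by
  -- Comparing the factors of `x`, `y` and `x + y` shows that they agree.
  have htransfer : ∀ (k : K) (c : L) (x y : V), LinearIndependent K ![x, y] →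
      f (k • x) = c • f x → f (k • y) = c • f y := by
    intro k c x y h hx
    obtain ⟨a, ha⟩ := hsmul k y
    obtain ⟨b, hb⟩ := hsmul k (x + y)
    rw [smul_add, map_add, map_add, hx, ha] at hb
    have h0 : (c - b) • f x + (a - b) • f y = 0 := by
      rw [← sub_eq_zero.2 hb]
      simp only [sub_smul, smul_add]
      abel
    obtain ⟨h1, h2⟩ := LinearIndependent.pair_iff.1 (hli x y h) _ _ h0
    rw [ha, sub_eq_zero.1 h1, sub_eq_zero.1 h2]
  obtain ⟨e, he⟩ := exists_ne (0 : V)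
  choose c hc using fun k => hsmul k e
  have hall : ∀ k x, f (k • x) = c k • f x := by
    intro k x
    by_cases hx : LinearIndependent K ![e, x]
    · exact htransfer k _ e x hx (hc k)
    · obtain ⟨z, hz⟩ := hpartner e he
      have hxe : x ∈ K ∙ e := by
        by_contra h
        exact hx (linearIndependent_pair_iff_notMem.2 ⟨he, h⟩)
      by_cases hx0 : x = 0
      · simp [hx0]
      · refine htransfer k _ z x (LinearIndependent.pair_symm_iff.1
          (linearIndependent_pair_iff_notMem.2 ⟨hx0, fun h => ?_⟩)) (htransfer k _ e z hz (hc k))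
        exact (linearIndependent_pair_iff_notMem.1 hz).2
          ((span_singleton_le_iff_mem _ _).2 hxe h)
  have hfe : f e ≠ 0 := by
    obtain ⟨z, hz⟩ := hpartner e he
    exact (hli e z hz).ne_zero 0
  have hinj : Function.Injective fun a : L => a • f e := smul_left_injective L hfe
  refine ⟨{ toFun := c, map_one' := hinj ?_, map_mul' := fun k l => hinj ?_,
            map_zero' := hinj ?_, map_add' := fun k l => hinj ?_ }, hall⟩
  · simp [← hc]
  · simp only [← hc]
    rw [mul_smul, hall, hc, smul_smul]
  · simp [← hc]
  · simp only [add_smul, ← hc, map_add]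

/-- The fundamental theorem of projective geometry: in dimension at least three, a collineation is
induced by a bijective semilinear map. -/
theorem IsCollineation.exists_semilinear {P : V → Submodule L W} (hP : IsCollineation K P)
    (hV : 3 ≤ Module.rank K V) :
    ∃ (σ : K ≃+* L) (s : V →ₛₗ[(σ : K →+* L)] W), Function.Bijective s ∧
      ∀ x, P x = L ∙ s x := by
  obtain ⟨f, hf⟩ := hP.exists_addMonoidHom hV
  have hpartner : ∀ x : V, x ≠ 0 → ∃ z, LinearIndependent K ![x, z] := by
    intro x hx
    obtain ⟨z, hz⟩ := exists_notMem_span_pair (K := K) hV x x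
    exact ⟨z, linearIndependent_pair_of_notMem_left hx hz⟩
  obtain ⟨e, he⟩ := exists_notMem_span_pair (K := K) hV 0 0
  have he0 : e ≠ 0 := by
    rintro rfl
    exact he (zero_mem _)
  have : Nontrivial V := ⟨e, 0, he0⟩
  obtain ⟨σ, hσ⟩ := exists_ringHom_map_smul (K := K) (L := L) f hpartner
    (fun x y => (hP.linearIndependent_pair_iff (hf x) (hf y)).2) (fun k x => by
      have := (hP.mem_span_singleton_iff (hf (k • x)) (hf x)).2
        (smul_mem _ k (mem_span_singleton_self x))
      obtain ⟨c, hc⟩ := mem_span_singleton.1 this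
      exact ⟨c, hc.symm⟩)
  -- The point of `f z - c • f x` on the line `⟨f x, f z⟩` is the image of a point `z - k • x`,
  -- which forces `c = σ k`.
  have hsurj : ∀ (c : L) (x : V), x ≠ 0 → ∃ k, σ k = c := by
    intro c x hx
    obtain ⟨z, hz⟩ := hpartner x hx
    have hz' := (hP.linearIndependent_pair_iff (hf x) (hf z)).2 hz
    obtain ⟨w, hw⟩ := hP.exists_span_eq (f z - c • f x)
    obtain ⟨a, b, rfl⟩ := mem_span_pair.1 ((hP.mem_span_pair_iff hw (hf x) (hf z)).1
      (mem_span_pair.2 ⟨-c, 1, by simp [sub_eq_add_neg, add_comm]⟩))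
    rw [hf, map_add, hσ, hσ] at hw
    obtain ⟨d, hd⟩ := mem_span_singleton.1 (hw ▸ mem_span_singleton_self (f z - c • f x))
    have h0 : (d * σ a + c) • f x + (d * σ b - 1) • f z = 0 := by
      rw [smul_add, smul_smul, smul_smul] at hd
      rw [← sub_eq_zero.2 hd]
      simp only [add_smul, sub_smul, one_smul]
      abel
    obtain ⟨h1, h2⟩ := LinearIndependent.pair_iff.1 hz' _ _ h0
    have hσb : σ b ≠ 0 := fun h => by simp [h] at h2
    have hd' : d = (σ b)⁻¹ := eq_inv_of_mul_eq_one_left (sub_eq_zero.1 h2)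
    refine ⟨-(b⁻¹ * a), ?_⟩
    rw [map_neg, map_mul, map_inv₀, ← hd']
    exact (eq_neg_of_add_eq_zero_right h1).symm
  let τ : K ≃+* L := RingEquiv.ofBijective σ ⟨σ.injective, fun c => hsurj c e he0⟩
  refine ⟨τ, { toFun := f, map_add' := map_add f, map_smul' := hσ }, ⟨?_, ?_⟩, hf⟩
  · exact (injective_iff_map_eq_zero f).2 fun x hx => (hP.eq_zero_iff (hf x)).1 hx
  · intro y
    obtain ⟨x, hx⟩ := hP.exists_span_eq y
    rw [hf] at hx
    obtain ⟨c, hc⟩ := mem_span_singleton.1 (hx ▸ mem_span_singleton_self y)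
    obtain ⟨k, hk⟩ := hsurj c e he0
    exact ⟨k • x, by rw [← hc, ← hk]; exact hσ k x⟩

end Collineation

/-! ### Closed subspaces of finite dimension -/

namespace DualPair

section Closed

variable {K E F : Type*} [DivisionRing K] [AddCommGroup E] [Module K E]
  [AddCommGroup F] [Module Kᵐᵒᵖ F] {B : E →ₗ[K] F →ₗ[Kᵐᵒᵖ] K}

theorem le_perpLeft_perpRight (A : Submodule K E) : A ≤ perpLeft B (perpRight B A) :=
  fun x hx _ hy => hy x hx

theorem isFClosed_iff_le {A : Submodule K E} :
    IsFClosed B A ↔ perpLeft B (perpRight B A) ≤ A :=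
  ⟨fun h => h.ge, fun h => le_antisymm (le_perpLeft_perpRight A) h⟩

theorem IsDualPair.isFClosed_bot (hB : IsDualPair B) : IsFClosed B (⊥ : Submodule K E) :=
  isFClosed_iff_le.2 fun x hx => (mem_bot K).2 <| hB.1 x fun y => hx y fun z hz => by
    rw [(mem_bot K).1 hz, map_zero, LinearMap.zero_apply]

/-- Adding a line to a closed subspace gives a closed subspace: if `y₀ ∈ A^⊥` has
`B x y₀ = 1` and `z ∈ (A + K x)^⊥⊥`, then `z - (B z y₀) x` lies in `A^⊥⊥ = A`. -/
theorem IsFClosed.sup_span_singleton {A : Submodule K E} (hA : IsFClosed B A) (x : E) :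
    IsFClosed B (A ⊔ K ∙ x) := by
  by_cases hx : x ∈ A
  · rwa [sup_eq_left.2 ((span_singleton_le_iff_mem _ _).2 hx)]
  obtain ⟨y₁, hy₁, hne⟩ : ∃ y ∈ perpRight B A, B x y ≠ 0 := by
    by_contra! h
    exact hx (isFClosed_iff_le.1 hA h)
  obtain ⟨y₀, hy₀, hone⟩ : ∃ y ∈ perpRight B A, B x y = 1 :=
    ⟨MulOpposite.op (B x y₁)⁻¹ • y₁, smul_mem _ _ hy₁, by
      rw [map_smul, op_smul_eq_mul, mul_inv_cancel₀ hne]⟩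
  refine isFClosed_iff_le.2 fun z hz => ?_
  have hmem : z - B z y₀ • x ∈ A := by
    refine isFClosed_iff_le.1 hA fun y hy => ?_
    have hperp : y - MulOpposite.op (B x y) • y₀ ∈ perpRight B (A ⊔ K ∙ x) := by
      intro w hw
      obtain ⟨a, ha, v, hv, rfl⟩ := mem_sup.1 hw
      obtain ⟨k, rfl⟩ := mem_span_singleton.1 hv
      simp [hy a ha, hy₀ a ha, hone]
    have h0 := hz _ hperp
    rw [map_sub, map_smul, op_smul_eq_mul] at h0
    rw [map_sub, map_smul, LinearMap.sub_apply, LinearMap.smul_apply, smul_eq_mul, h0]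
  rw [← sub_add_cancel z (B z y₀ • x)]
  exact add_mem (mem_sup_left hmem)
    (mem_sup_right (smul_mem _ _ (mem_span_singleton_self x)))

theorem IsDualPair.isFClosed_span_singleton (hB : IsDualPair B) (x : E) :
    IsFClosed B (K ∙ x) := by
  simpa using hB.isFClosed_bot.sup_span_singleton x

theorem IsDualPair.isFClosed_span_pair (hB : IsDualPair B) (x y : E) :
    IsFClosed B (span K {x, y}) := by
  rw [Set.pair_comm, span_insert, sup_comm]
  exact (hB.isFClosed_span_singleton x).sup_span_singleton y

/-- The line `K ∙ x` as a closed subspace; it is zero for `x = 0`. -/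
def IsDualPair.line (hB : IsDualPair B) (x : E) : ClosedSubspaces B :=
  ⟨K ∙ x, hB.isFClosed_span_singleton x⟩

theorem IsDualPair.line_le_iff (hB : IsDualPair B) {x : E} {M : ClosedSubspaces B} :
    hB.line x ≤ M ↔ x ∈ (M : Submodule K E) :=
  span_singleton_le_iff_mem x _

theorem IsDualPair.eq_line_of_le (hB : IsDualPair B) {x y : E} (hy : y ≠ 0)
    (h : hB.line y ≤ hB.line x) : hB.line y = hB.line x := by
  obtain ⟨a, rfl⟩ := mem_span_singleton.1 (hB.line_le_iff.1 h)
  have ha : a ≠ 0 := fun h0 => hy (by simp [h0])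
  exact Subtype.ext (span_singleton_smul_eq ha.isUnit x)

end Closed

/-! ### The collineation of a lattice isomorphism -/

section OrderIso

variable {K₁ K₂ E₁ E₂ F₁ F₂ : Type*} [DivisionRing K₁] [DivisionRing K₂]
  [AddCommGroup E₁] [Module K₁ E₁] [AddCommGroup F₁] [Module K₁ᵐᵒᵖ F₁]
  [AddCommGroup E₂] [Module K₂ E₂] [AddCommGroup F₂] [Module K₂ᵐᵒᵖ F₂]
  {B₁ : E₁ →ₗ[K₁] F₁ →ₗ[K₁ᵐᵒᵖ] K₁} {B₂ : E₂ →ₗ[K₂] F₂ →ₗ[K₂ᵐᵒᵖ] K₂}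

/-- An isomorphism of lattices of closed subspaces maps lines to lines, because they are the
atoms. -/
theorem exists_apply_line_eq (hB₁ : IsDualPair B₁) (hB₂ : IsDualPair B₂)
    (ψ : ClosedSubspaces B₁ ≃o ClosedSubspaces B₂) (x : E₁) :
    ∃ y, ψ (hB₁.line x) = hB₂.line y := by
  by_cases h : ((ψ (hB₁.line x) : ClosedSubspaces B₂) : Submodule K₂ E₂) = ⊥
  · exact ⟨0, Subtype.ext (h.trans (span_zero_singleton K₂).symm)⟩
  obtain ⟨y, hy, hy0⟩ := exists_mem_ne_zero_of_ne_bot h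
  refine ⟨y, ?_⟩
  have hle : hB₂.line y ≤ ψ (hB₁.line x) := hB₂.line_le_iff.2 hy
  rw [← ψ.symm_apply_le] at hle
  by_cases h' : ((ψ.symm (hB₂.line y) : ClosedSubspaces B₁) : Submodule K₁ E₁) = ⊥
  · -- The preimage of the line of `y` would be the least closed subspace.
    have hbot : ψ.symm (hB₂.line y) ≤ ψ.symm (hB₂.line 0) := by
      rw [← Subtype.coe_le_coe, h']
      exact bot_le
    rw [ψ.symm.le_iff_le, hB₂.line_le_iff] at hbot
    exact absurd (by simpa [IsDualPair.line] using hbot) hy0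
  · obtain ⟨z, hz, hz0⟩ := exists_mem_ne_zero_of_ne_bot h'
    have hzy : hB₁.line z ≤ ψ.symm (hB₂.line y) := hB₁.line_le_iff.2 hz
    have hzx := hB₁.eq_line_of_le hz0 (hzy.trans hle)
    rw [← ψ.symm.injective.eq_iff, ψ.symm_apply_apply]
    exact le_antisymm (hzx ▸ hzy) hle

theorem isCollineation_apply_line (hB₁ : IsDualPair B₁) (hB₂ : IsDualPair B₂)
    (ψ : ClosedSubspaces B₁ ≃o ClosedSubspaces B₂) :
    IsCollineation K₁ fun x => (ψ (hB₁.line x) : Submodule K₂ E₂) where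
  exists_eq_span x := by
    obtain ⟨y, hy⟩ := exists_apply_line_eq hB₁ hB₂ ψ x
    exact ⟨y, congrArg Subtype.val hy⟩
  exists_span_eq y := by
    obtain ⟨x, hx⟩ := exists_apply_line_eq hB₂ hB₁ ψ.symm y
    refine ⟨x, congrArg Subtype.val (?_ : ψ (hB₁.line x) = hB₂.line y)⟩
    rw [← hx, ψ.apply_symm_apply]
  le_sup_iff x y z := by
    let M : ClosedSubspaces B₁ := ⟨span K₁ {y, z}, hB₁.isFClosed_span_pair y z⟩
    have hy : ψ (hB₁.line y) ≤ ψ M :=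
      ψ.monotone (hB₁.line_le_iff.2 (subset_span (by simp)))
    have hz : ψ (hB₁.line z) ≤ ψ M :=
      ψ.monotone (hB₁.line_le_iff.2 (subset_span (by simp)))
    constructor
    · intro h
      have : ψ (hB₁.line x) ≤ ψ M := h.trans (sup_le hy hz)
      rwa [ψ.le_iff_le, hB₁.line_le_iff] at this
    · intro h
      -- The sum of the two image lines is closed, so that it bounds the image of `M`.
      obtain ⟨y', hy'⟩ := exists_apply_line_eq hB₁ hB₂ ψ y
      obtain ⟨z', hz'⟩ := exists_apply_line_eq hB₁ hB₂ ψ z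
      let N : ClosedSubspaces B₂ := ⟨span K₂ {y', z'}, hB₂.isFClosed_span_pair y' z'⟩
      have hN : (N : Submodule K₂ E₂) =
          (ψ (hB₁.line y) : Submodule K₂ E₂) ⊔ (ψ (hB₁.line z) : Submodule K₂ E₂) := by
        rw [hy', hz']
        exact span_insert y' {z'}
      have hyN : ψ (hB₁.line y) ≤ N := Subtype.coe_le_coe.1 (hN ▸ le_sup_left)
      have hzN : ψ (hB₁.line z) ≤ N := Subtype.coe_le_coe.1 (hN ▸ le_sup_right)
      rw [← ψ.le_symm_apply, hB₁.line_le_iff] at hyN hzN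
      have hMN : M ≤ ψ.symm N := span_le.2 (by
        rintro w (rfl | rfl)
        · exact hyN
        · exact hzN)
      have hxN : ψ (hB₁.line x) ≤ N := by
        rw [← ψ.le_symm_apply]
        exact (hB₁.line_le_iff.2 h : hB₁.line x ≤ M).trans hMN
      exact hN ▸ Subtype.coe_le_coe.2 hxN

end OrderIso

end DualPair

theorem proposition2
    {K₁ K₂ E₁ E₂ F₁ F₂ : Type*} [DivisionRing K₁] [DivisionRing K₂]
    [AddCommGroup E₁] [Module K₁ E₁] [AddCommGroup F₁] [Module K₁ᵐᵒᵖ F₁]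
    [AddCommGroup E₂] [Module K₂ E₂] [AddCommGroup F₂] [Module K₂ᵐᵒᵖ F₂]
    (B₁ : E₁ →ₗ[K₁] F₁ →ₗ[K₁ᵐᵒᵖ] K₁) (hB₁ : DualPair.IsDualPair B₁)
    (B₂ : E₂ →ₗ[K₂] F₂ →ₗ[K₂ᵐᵒᵖ] K₂) (hB₂ : DualPair.IsDualPair B₂)
    (hdim : 3 ≤ Module.rank K₁ E₁)
    (ψ : DualPair.ClosedSubspaces B₁ ≃o DualPair.ClosedSubspaces B₂) :
    ∃ (σ : K₁ ≃+* K₂) (s : E₁ →ₛₗ[(σ : K₁ →+* K₂)] E₂), Function.Bijective s ∧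
      ∀ M : DualPair.ClosedSubspaces B₁,
        ((ψ M : Submodule K₂ E₂) : Set E₂) = s '' ((M : Submodule K₁ E₁) : Set E₁) := by
  obtain ⟨σ, s, hs, hline⟩ :=
    (DualPair.isCollineation_apply_line hB₁ hB₂ ψ).exists_semilinear hdim
  refine ⟨σ, s, hs, fun M => ?_⟩
  have hmem : ∀ x, s x ∈ (ψ M : Submodule K₂ E₂) ↔ x ∈ (M : Submodule K₁ E₁) := by
    intro x
    rw [← span_singleton_le_iff_mem, ← hline x, Subtype.coe_le_coe, ψ.le_iff_le,
      hB₁.line_le_iff]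
  ext y
  obtain ⟨x, rfl⟩ := hs.2 y
  rw [hs.1.mem_set_image]
  exact hmem x
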